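/- Consider the 7-nested-loop convolution with positive integer sizes $N, c_I, c_O, w_O, h_O, w_F, h_F$ and positive integer strides $\sigma_w \le w_F$, $\sigma_h \le h_F$: for all $0\le i_1<N$, $0\le i_2<c_I$, $0\le i_3<c_O$, $0\le i_4<w_O$, $0\le i_5<h_O$, $0\le i_6<w_F$, $0\le i_7<h_F$, in any order, perform the update \[ \mathrm{Output}(i_1,i_3,i_4,i_5) \mathrel{+}= \mathrm{Input}(i_1,i_2,\sigma_w i_4+i_6,\sigma_h i_5+i_7)\times \mathrm{Filter}(i_2,i_3,i_6,i_7). \] Let $G=Nc_Ic_Ow_Oh_Ow_Fh_F$ be the number of updates, and let $|I|=Nc_I(\sigma_w(w_O-1)+w_F)(\sigma_h(h_O-1)+h_F)$, $|F|=c_Ic_Ow_Fh_F$, $|O|=Nc_Ow_Oh_O$ be the numbers of entries of the three (non-overlapping) arrays that the computation uses. An entry of Input, Filter, Output occupies $p_I,p_F,p_O>0$ words respectively; put $p_T=p_I+p_F+p_O$. Consider a machine with a main memory and a fast memory of $M>0$ words. The data begin in main memory, the fast memory is initially empty, and the Output array is initially zero. An update can be executed only while the three entries it involves are in fast memory; an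 Output entry gets into fast memory either by being loaded or by setting up there, at no cost, an accumulator with value zero. Dropping data from fast memory is free. At the end the complete Output must be in main memory. Loading an entry from main memory to fast memory, or storing one back, communicates as many words as the entry occupies. Let $X$ be the total number of words communicated by an execution of the convolution on this machine. Then every execution satisfies \[ X \ge \max\Big\{p_I|I|+p_F|F|+p_O|O|,\ \frac{C_p G}{M}-M\Big\}, \] and if moreover $\sigma_w$ divides $w_F$ and $\sigma_h$ divides $h_F$, then \[ X \ge \max\Big\{p_I|I|+p_F|F|+p_O|O|,\ \frac{C_p G}{M}-M,\ \frac{2(p_Ip_Fp_O)^{1/2}(\sigma_w\sigma_h)^{1/2}G}{(w_Fh_FM)^{1/2}}-2M\Big\}. \] Here $C_p=\tfrac14 p_T^2$ if $p_j\le p_k+p_\ell$ for all distinct $j,k,\ell\in\{I,F,O\}$, and $C_p=p_j(p_k+p_\ell)$ if $p_j>p_k+p_\ell$ for some distinct $j,k,\ell$. -/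

import Mathlib

/-- Sizes of one convolution layer: number of images `N`, of input channels `cI`, of output
channels `cO`, output width and height `wO`, `hO`, filter width and height `wF`, `hF`, and
horizontal and vertical strides `sw`, `sh`. -/
structure ConvLayer where
  N : ℕ
  cI : ℕ
  cO : ℕ
  wO : ℕ
  hO : ℕ
  wF : ℕ
  hF : ℕ
  sw : ℕ
  sh : ℕ

/-- The number of words taken by one entry of each of the three arrays. -/
structure Precisions where
  I : ℝ
  F : ℝ
  O : ℝ

namespace ConvLayer

variable (L : ConvLayer)

/-- Width of Input: the horizontal positions `sw * i₄ + i₆` range over `0, …, inW - 1`. -/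
abbrev inW : ℕ := L.sw * (L.wO - 1) + L.wF

/-- Height of Input: the vertical positions `sh * i₅ + i₇` range over `0, …, inH - 1`. -/
abbrev inH : ℕ := L.sh * (L.hO - 1) + L.hF

/-- The iterations `(i₁, …, i₇)` of the seven nested loops. -/
abbrev Iter : Type :=
  Fin L.N × Fin L.cI × Fin L.cO × Fin L.wO × Fin L.hO × Fin L.wF × Fin L.hF

abbrev InputIdx : Type := Fin L.N × Fin L.cI × Fin L.inW × Fin L.inH

abbrev FilterIdx : Type := Fin L.cI × Fin L.cO × Fin L.wF × Fin L.hF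

abbrev OutputIdx : Type := Fin L.N × Fin L.cO × Fin L.wO × Fin L.hO

/-- `|I|`, the number of entries of Input. -/
def sizeI : ℕ := L.N * L.cI * L.inW * L.inH

/-- `|F|`, the number of entries of Filter. -/
def sizeF : ℕ := L.cI * L.cO * L.wF * L.hF

/-- `|O|`, the number of entries of Output. -/
def sizeO : ℕ := L.N * L.cO * L.wO * L.hO

/-- `G`, the number of updates. -/
def numUpdates : ℕ := L.N * L.cI * L.cO * L.wO * L.hO * L.wF * L.hF

theorem stride_lt {s n w i j : ℕ} (hi : i < n) (hj : j < w) : s * i + j < s * (n - 1) + w :=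
  Nat.add_lt_add_of_le_of_lt (Nat.mul_le_mul_left s (Nat.le_sub_one_of_lt hi)) hj

/-- The update of iteration `(i₁, …, i₇)` reads `Input(i₁, i₂, sw * i₄ + i₆, sh * i₅ + i₇)`. -/
def inputOf : L.Iter → L.InputIdx
  | (i₁, i₂, _, i₄, i₅, i₆, i₇) =>
    (i₁, i₂, ⟨L.sw * i₄ + i₆, stride_lt i₄.isLt i₆.isLt⟩,
      ⟨L.sh * i₅ + i₇, stride_lt i₅.isLt i₇.isLt⟩)

/-- The update of iteration `(i₁, …, i₇)` reads `Filter(i₂, i₃, i₆, i₇)`. -/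
def filterOf : L.Iter → L.FilterIdx
  | (_, i₂, i₃, _, _, i₆, i₇) => (i₂, i₃, i₆, i₇)

/-- The update of iteration `(i₁, …, i₇)` is added to `Output(i₁, i₃, i₄, i₅)`. -/
def outputOf : L.Iter → L.OutputIdx
  | (i₁, _, i₃, i₄, i₅, _, _) => (i₁, i₃, i₄, i₅)

/-- An entry of one of the three (non-overlapping) arrays. -/
inductive Entry where
  | input (a : L.InputIdx)
  | filter (a : L.FilterIdx)
  | output (a : L.OutputIdx)
  deriving DecidableEq

variable {L}

/-- The number of words of an entry. -/
def Entry.words (p : Precisions) : L.Entry → ℝ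
  | .input _ => p.I
  | .filter _ => p.F
  | .output _ => p.O

variable (L)

/-- A state of the two-level memory. Entries of Input and Filter never change, so only the
values of Output entries are recorded. Such a value is a partial sum, recorded as the multiset
of the iterations whose products `Input * Filter` have been added up in it. -/
structure MemState where
  /-- the entries that have a copy in fast memory -/
  cached : Finset L.Entry
  /-- the value of the fast memory copy of an Output entry (meaningful if it is cached) -/
  fast : L.OutputIdx → Multiset L.Iter
  /-- the value of an Output entry in main memory -/
  main : L.OutputIdx → Multiset L.Iter

/-- At the start all data are in main memory, fast memory is empty, and Output is zero. -/
def MemState.initial : L.MemState where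
  cached := ∅
  fast := fun _ => 0
  main := fun _ => 0

/-- The instructions of the machine. -/
inductive Instr where
  /-- copy an entry from main memory to fast memory -/
  | load (e : L.Entry)
  /-- copy an entry from fast memory to main memory -/
  | store (e : L.Entry)
  /-- set up an accumulator for an Output entry in fast memory, with value zero -/
  | alloc (o : L.OutputIdx)
  /-- drop the fast memory copy of an entry -/
  | evict (e : L.Entry)
  /-- execute the update of an iteration in fast memory -/
  | update (x : L.Iter)

variable {L}

/-- The number of words of fast memory that are in use. -/
def MemState.used (p : Precisions) (s : L.MemState) : ℝ := ∑ e ∈ s.cached, e.words p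

/-- The effect of an instruction on the memory. -/
def Instr.exec : L.Instr → L.MemState → L.MemState
  | .load (.output o), s =>
    { s with
      cached := insert (.output o) s.cached
      fast := Function.update s.fast o (s.main o) }
  | .load e, s => { s with cached := insert e s.cached }
  | .store (.output o), s => { s with main := Function.update s.main o (s.fast o) }
  | .store _, s => s
  | .alloc o, s =>
    { s with
      cached := insert (.output o) s.cached
      fast := Function.update s.fast o 0 }
  | .evict e, s => { s with cached := s.cached.erase e }
  | .update x, s =>
    { s with fast := Function.update s.fast (L.outputOf x) (x ::ₘ s.fast (L.outputOf x)) }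

/-- What an instruction needs: operands of a store or an update must be in fast memory. (An
entry that is in fast memory may be evicted at no cost before it is loaded again.) -/
def Instr.Ready : L.Instr → L.MemState → Prop
  | .load e, s => e ∉ s.cached
  | .store e, s => e ∈ s.cached
  | .alloc o, s => .output o ∉ s.cached
  | .evict _, _ => True
  | .update x, s =>
    .input (L.inputOf x) ∈ s.cached ∧ .filter (L.filterOf x) ∈ s.cached ∧
      .output (L.outputOf x) ∈ s.cached

/-- The number of words that an instruction moves between main memory and fast memory. -/
def Instr.cost (p : Precisions) : L.Instr → ℝ
  | .load e => e.words p
  | .store e => e.words p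
  | .alloc _ => 0
  | .evict _ => 0
  | .update _ => 0

/-- `Runs p M s P t`: with `M` words of fast memory, the sequence of instructions `P` can be
executed from state `s` and ends in state `t`. -/
inductive Runs (p : Precisions) (M : ℝ) : L.MemState → List L.Instr → L.MemState → Prop
  | nil (s : L.MemState) : Runs p M s [] s
  | cons {s t : L.MemState} {i : L.Instr} {P : List L.Instr} (ready : i.Ready s)
      (fits : (i.exec s).used p ≤ M) (rest : Runs p M (i.exec s) P t) : Runs p M s (i :: P) t

/-- The Output array in main memory is the convolution: every entry is the sum of all its
updates, each taken once. -/
def MemState.Complete (s : L.MemState) : Prop :=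
  ∀ o, s.main o = (Finset.univ.filter fun x : L.Iter => L.outputOf x = o).val

/-- `P` is an execution of the convolution with `M` words of fast memory. -/
def IsComputation (p : Precisions) (M : ℝ) (P : List L.Instr) : Prop :=
  ∃ t, Runs p M (MemState.initial L) P t ∧ t.Complete

/-- The number of words communicated by a sequence of instructions. -/
def wordsMoved (p : Precisions) (P : List L.Instr) : ℝ := (P.map (Instr.cost p)).sum

end ConvLayer

/-- The constant `C_p`: `p_T ^ 2 / 4` if none of the precisions exceeds the sum of the other two,
and `p_j * (p_k + p_l)` if `p_j > p_k + p_l`. -/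
noncomputable def Precisions.C (p : Precisions) : ℝ :=
  if p.I > p.F + p.O then p.I * (p.F + p.O)
  else if p.F > p.I + p.O then p.F * (p.I + p.O)
  else if p.O > p.I + p.F then p.O * (p.I + p.F)
  else (p.I + p.F + p.O) ^ 2 / 4

/-!
The idea is that of Hong and Kung: cut an execution into segments of bounded communication, and
bound the number of updates in a segment by the numbers of entries available in it.

*Charging Output entries when they enter.* Setting up an accumulator is free, so the entries
available in a segment are not bounded by the loads alone. But the updates made in an accumulator
reach main memory only if it is stored before it is evicted, and this store can be paid for in
advance, when the accumulator is set up; accumulators that are never stored are left out together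
with their updates. Thus an execution is simulated by a schedule of a cache in which every
entrance of an entry costs its number of words (`ConvLayer.Runs.exists_cacheSchedule`), at no
greater total cost. Every entry is used, so every entry is paid for at least once, which is the
first bound.

*Segments.* Cut such a schedule whenever its cumulative cost passes a multiple of `T ≥ M`. A load
across the cut is counted to the contents at the start of the next segment, which fit into `M`
words. So the entries available in a segment have at most `M + T` words. If these enable at most
`K` updates, then the number `G` of all updates is at most `K * (X / T + 1)`
(`CacheSchedule.mul_card_le`).

*Counting updates.* Let `n` updates involve `x`, `y`, `z` entries of Input, Filter, Output. Two of
the three operands determine an update, so `n ≤ min (x * y) (x * z) (y * z)`, and for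
`p.I * x + p.F * y + p.O * z ≤ 2 * M` this gives `n ≤ M ^ 2 / C` (`Precisions.C_mul_le`). This is the
second bound, with `T = M`. If the strides divide the filter sizes, a Loomis–Whitney argument gives
`n ^ 2 ≤ (wF / sw) * (hF / sh) * x * y * z` (`ConvLayer.card_sq_le`), where by AM-GM the weighted
product of `x`, `y`, `z` is at most `M ^ 3` if their weighted sum is at most `3 * M`. This is the
third bound, with `T = 2 * M`.
-/

open Finset

/-! ### Schedules of a cache -/

/-- `CacheSchedule D w M C c V`: a cache of capacity `M`, starting with contents `C`, can execute
all the tasks of `V` at total loading cost `c`. A task `x` needs the entries `D x` in the cache,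
loading an entry `e` costs `w e`, and dropping entries is free. -/
inductive CacheSchedule {E X : Type*} [DecidableEq E] [DecidableEq X] (D : X → Finset E)
    (w : E → ℝ) (M : ℝ) : Finset E → ℝ → Finset X → Prop
  | done (C : Finset E) : CacheSchedule D w M C 0 ∅
  | load {C : Finset E} {c : ℝ} {V : Finset X} (e : E) (fits : ∑ a ∈ insert e C, w a ≤ M)
      (rest : CacheSchedule D w M (insert e C) c V) : CacheSchedule D w M C (w e + c) V
  | drop {C C' : Finset E} {c : ℝ} {V : Finset X} (sub : C' ⊆ C)
      (rest : CacheSchedule D w M C' c V) : CacheSchedule D w M C c V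
  | exec {C : Finset E} {c : ℝ} {V : Finset X} (x : X) (ready : D x ⊆ C)
      (rest : CacheSchedule D w M C c V) : CacheSchedule D w M C c (insert x V)

namespace CacheSchedule

variable {E X : Type*} [DecidableEq E] [DecidableEq X] {D : X → Finset E} {w : E → ℝ} {M : ℝ}

theorem sum_insert_le (hw : ∀ e, 0 ≤ w e) (e : E) (N : Finset E) :
    ∑ a ∈ insert e N, w a ≤ w e + ∑ a ∈ N, w a := by
  by_cases he : e ∈ N
  · rw [insert_eq_of_mem he]
    linarith [hw e]
  · rw [sum_insert he]

theorem cost_nonneg (hw : ∀ e, 0 ≤ w e) {C : Finset E} {c : ℝ} {V : Finset X}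
    (h : CacheSchedule D w M C c V) : 0 ≤ c := by
  induction h with
  | done => exact le_rfl
  | load e _ _ ih => linarith [hw e]
  | drop _ _ ih => exact ih
  | exec _ _ _ ih => exact ih

/-- Every entry that is needed is in the cache at the start or paid for by a load. -/
theorem exists_loaded (hw : ∀ e, 0 ≤ w e) {C : Finset E} {c : ℝ} {V : Finset X}
    (h : CacheSchedule D w M C c V) :
    ∃ N : Finset E, ∑ a ∈ N, w a ≤ c ∧ ∀ x ∈ V, D x ⊆ C ∪ N := by
  induction h with
  | done => exact ⟨∅, by simp, by simp⟩
  | @load C c V e _ _ ih =>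
    obtain ⟨N, hN, hV⟩ := ih
    refine ⟨insert e N, (sum_insert_le hw e N).trans (by linarith), fun x hx => ?_⟩
    rw [union_insert, ← insert_union]
    exact hV x hx
  | drop sub _ ih =>
    obtain ⟨N, hN, hV⟩ := ih
    exact ⟨N, hN, fun x hx => (hV x hx).trans (union_subset_union_left sub)⟩
  | exec x ready _ ih =>
    obtain ⟨N, hN, hV⟩ := ih
    refine ⟨N, hN, fun y hy => ?_⟩
    rcases mem_insert.1 hy with rfl | hy
    · exact ready.trans subset_union_left
    · exact hV y hy

/-- A schedule is cut into segments each time its cumulative cost passes a multiple of `T`. Here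
`r` is the cost left in the current segment, `V₀` consists of the tasks executed in that segment,
`N` of the entries loaded in it, and `m` is the number of the segments that follow it. -/
theorem exists_segments (hw : ∀ e, 0 ≤ w e) {T K : ℝ} (hMT : M ≤ T)
    (hK : ∀ (V : Finset X) (S : Finset E), ∑ a ∈ S, w a ≤ M + T → (∀ x ∈ V, D x ⊆ S) →
      (#V : ℝ) ≤ K)
    {C : Finset E} {c : ℝ} {V : Finset X} (h : CacheSchedule D w M C c V) :
    ∀ r, 0 ≤ r → r ≤ T → ∃ (V₀ : Finset X) (N : Finset E) (m : ℕ), ∑ a ∈ N, w a ≤ r ∧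
      (∀ x ∈ V₀, D x ⊆ C ∪ N) ∧ (#(V \ V₀) : ℝ) ≤ K * m ∧ (m = 0 ∨ m * T ≤ c - r + T) := by
  induction h with
  | done => exact fun r hr _ => ⟨∅, ∅, 0, by simpa, by simp, by simp, Or.inl rfl⟩
  | @load C c V e fits rest ih =>
    intro r hr hrT
    by_cases her : w e ≤ r
    · obtain ⟨V₀, N, m, hN, hV₀, hV, hm⟩ := ih (r - w e) (by linarith) (by linarith [hw e])
      refine ⟨V₀, insert e N, m, (sum_insert_le hw e N).trans (by linarith), fun x hx => ?_, hV,
        hm.imp_right fun hm => by linarith⟩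
      rw [union_insert, ← insert_union]
      exact hV₀ x hx
    · have heM : w e ≤ M :=
        (single_le_sum (fun a _ => hw a) (mem_insert_self e C)).trans fits
      -- The load of `e` straddles the end of the segment. The next segment is counted from the
      -- state after this load, whose contents still fit into the cache.
      obtain ⟨V₀, N, m, hN, hV₀, hV, hm⟩ := ih (T - (w e - r)) (by linarith) (by linarith)
      have hcard : (#V₀ : ℝ) ≤ K := by
        refine hK V₀ (insert e C ∪ N) ?_ hV₀
        have := sum_union_inter (s₁ := insert e C) (s₂ := N) (f := w)
        have := sum_nonneg fun a (_ : a ∈ insert e C ∩ N) => hw a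
        linarith
      have hle : (#V : ℝ) ≤ #(V \ V₀) + #V₀ := by exact_mod_cast card_le_card_sdiff_add_card
      refine ⟨∅, ∅, m + 1, by simpa, by simp, ?_, Or.inr ?_⟩
      · rw [sdiff_empty]
        push_cast
        linarith
      · push_cast
        rcases hm with rfl | hm
        · have := cost_nonneg hw rest
          norm_num
          linarith
        · linarith
  | drop sub _ ih =>
    intro r hr hrT
    obtain ⟨V₀, N, m, hN, hV₀, hV, hm⟩ := ih r hr hrT
    exact ⟨V₀, N, m, hN, fun x hx => (hV₀ x hx).trans (union_subset_union_left sub), hV, hm⟩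
  | @exec C c V x ready _ ih =>
    intro r hr hrT
    obtain ⟨V₀, N, m, hN, hV₀, hV, hm⟩ := ih r hr hrT
    refine ⟨insert x V₀, N, m, hN, fun y hy => ?_, le_trans ?_ hV, hm⟩
    · rcases mem_insert.1 hy with rfl | hy
      · exact ready.trans subset_union_left
      · exact hV₀ y hy
    · have : insert x V \ insert x V₀ ⊆ V \ V₀ := by
        intro y
        simp only [mem_sdiff, mem_insert]
        tauto
      exact_mod_cast card_le_card this

/-- If `M + T` words of entries enable at most `K` tasks, then a schedule of cost `c` executes at
most `K * (c / T + 1)` tasks. -/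
theorem mul_card_le (hw : ∀ e, 0 ≤ w e) {T K : ℝ} (hM : 0 < M) (hMT : M ≤ T)
    (hK : ∀ (V : Finset X) (S : Finset E), ∑ a ∈ S, w a ≤ M + T → (∀ x ∈ V, D x ⊆ S) →
      (#V : ℝ) ≤ K)
    {c : ℝ} {V : Finset X} (h : CacheSchedule D w M ∅ c V) : T * #V ≤ K * (c + T) := by
  obtain ⟨V₀, N, m, hN, hV₀, hV, hm⟩ := exists_segments hw hMT hK h T (by linarith) le_rfl
  have hcard : (#V₀ : ℝ) ≤ K := hK V₀ N (by linarith) (by simpa using hV₀)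
  have hle : (#V : ℝ) ≤ #(V \ V₀) + #V₀ := by exact_mod_cast card_le_card_sdiff_add_card
  have hmc : m * T ≤ c := by
    rcases hm with rfl | hm
    · simpa using cost_nonneg hw h
    · linarith
  have hK0 : 0 ≤ K := (Nat.cast_nonneg _).trans hcard
  calc T * #V ≤ T * (K * (m + 1)) := by
        refine mul_le_mul_of_nonneg_left ?_ (by linarith)
        linarith
    _ = K * (m * T + T) := by ring
    _ ≤ K * (c + T) := by gcongr

end CacheSchedule

namespace ConvLayer

variable {L : ConvLayer}

/-! ### From programs to cache schedules -/

/-- The three entries that an update involves. -/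
def operands (x : L.Iter) : Finset L.Entry :=
  {.input (L.inputOf x), .filter (L.filterOf x), .output (L.outputOf x)}

/-- The Output entries that a program stores before it evicts them: the value that such an entry
has in fast memory at the start of the program gets into main memory. -/
def pendingStores : List L.Instr → Finset L.OutputIdx
  | [] => ∅
  | .store (.output o) :: P => insert o (pendingStores P)
  | .evict (.output o) :: P => (pendingStores P).erase o
  | .load _ :: P => pendingStores P
  | .store (.input _) :: P => pendingStores P
  | .store (.filter _) :: P => pendingStores P
  | .alloc _ :: P => pendingStores P
  | .evict (.input _) :: P => pendingStores P
  | .evict (.filter _) :: P => pendingStores P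
  | .update _ :: P => pendingStores P

theorem Entry.words_pos {p : Precisions} (hpI : 0 < p.I) (hpF : 0 < p.F) (hpO : 0 < p.O)
    (e : L.Entry) : 0 < e.words p := by
  cases e <;> assumption

/-- A run of the machine is simulated by a schedule that pays for an Output entry when it gets
into fast memory. An accumulator set up at no cost is paid for by the store that ends its use; if
it is never stored, the schedule leaves it out, since the updates made in it do not reach main
memory. The contents `C` of the simulating cache are the fast memory without such accumulators,
and the stores still to come for entries of `C` are credit that has been spent. -/
theorem Runs.exists_cacheSchedule {p : Precisions} {M : ℝ} (hw : ∀ e : L.Entry, 0 ≤ e.words p)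
    (hpO : 0 ≤ p.O) {s t : L.MemState} {P : List L.Instr} (h : Runs p M s P t) :
    ∀ C ⊆ s.cached, (∀ a, .input a ∈ s.cached → .input a ∈ C) →
      (∀ a, .filter a ∈ s.cached → .filter a ∈ C) →
      (∀ o ∈ pendingStores P, .output o ∈ s.cached → .output o ∈ C) →
      ∃ (c : ℝ) (V : Finset L.Iter), CacheSchedule operands (Entry.words p) M C c V ∧
        c + p.O * #{o ∈ pendingStores P | .output o ∈ C} ≤ wordsMoved p P ∧
        ∀ x, x ∈ t.main (L.outputOf x) → x ∈ s.main (L.outputOf x) ∨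
          (x ∈ s.fast (L.outputOf x) ∧ .output (L.outputOf x) ∈ s.cached ∧
            L.outputOf x ∈ pendingStores P) ∨ x ∈ V := by
  induction h with
  | nil s =>
    intro C _ _ _ _
    exact ⟨0, ∅, .done C, by simp [pendingStores, wordsMoved], fun x hx => Or.inl hx⟩
  | @cons s t i P ready fits rest ih =>
    intro C hC hI hF hO
    have hfit : ∀ e, insert e C ⊆ (i.exec s).cached → ∑ a ∈ insert e C, a.words p ≤ M :=
      fun e he => (sum_le_sum_of_subset_of_nonneg he fun a _ _ => hw a).trans fits
    have hmono : ∀ A B : Finset L.OutputIdx, A ⊆ B → p.O * (#A : ℝ) ≤ p.O * #B :=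
      fun A B hAB => mul_le_mul_of_nonneg_left (by exact_mod_cast card_le_card hAB) hpO
    have hmoved : wordsMoved p (i :: P) = i.cost p + wordsMoved p P := by simp [wordsMoved]
    rw [hmoved]
    cases i with
    | load e =>
      have hexec : ((Instr.load e).exec s).cached = insert e s.cached := by cases e <;> rfl
      have hC' : insert e C ⊆ ((Instr.load e).exec s).cached :=
        hexec ▸ insert_subset_insert e hC
      obtain ⟨c, V, hs, hcost, hcov⟩ := ih (insert e C) hC'
        (fun a ha => by
          rw [hexec, mem_insert] at ha
          exact mem_insert.2 (ha.imp_right (hI a)))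
        (fun a ha => by
          rw [hexec, mem_insert] at ha
          exact mem_insert.2 (ha.imp_right (hF a)))
        (fun o ho ha => by
          rw [hexec, mem_insert] at ha
          exact mem_insert.2 (ha.imp_right (hO o ho)))
      refine ⟨e.words p + c, V, .load e (hfit e hC') hs, ?_, fun x hx => ?_⟩
      · have := hmono {o ∈ pendingStores P | .output o ∈ C}
          {o ∈ pendingStores P | .output o ∈ insert e C}
          (monotone_filter_right _ fun o _ ho => mem_insert_of_mem ho)
        simp only [pendingStores, Instr.cost]
        linarith
      · have := hcov x hx
        rw [hexec] at this
        cases e with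
        | input a => simpa [Instr.exec, pendingStores] using this
        | filter a => simpa [Instr.exec, pendingStores] using this
        | output o =>
          by_cases ho : L.outputOf x = o
          · subst ho
            simp only [Instr.exec, Function.update_self] at this
            tauto
          · simpa [Instr.exec, pendingStores, Function.update_of_ne ho, ho] using this
    | store e =>
      cases e with
      | output o =>
        obtain ⟨c, V, hs, hcost, hcov⟩ := ih C hC hI hF
          (fun o' ho' => hO o' (mem_insert_of_mem ho'))
        refine ⟨c, V, hs, ?_, fun x hx => ?_⟩
        · have h1 : #{o' ∈ pendingStores (.store (.output o) :: P) | Entry.output o' ∈ C} ≤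
              #{o' ∈ pendingStores P | Entry.output o' ∈ C} + 1 := by
            refine le_trans (card_le_card ?_) (card_insert_le o _)
            intro o'
            simp only [pendingStores, mem_filter, mem_insert]
            tauto
          have h2 : (#{o' ∈ pendingStores (.store (.output o) :: P) | Entry.output o' ∈ C} : ℝ) ≤
              #{o' ∈ pendingStores P | Entry.output o' ∈ C} + 1 := by exact_mod_cast h1
          have h3 := mul_le_mul_of_nonneg_left h2 hpO
          simp only [Instr.cost, Entry.words]
          linarith
        · have := hcov x hx
          by_cases ho : L.outputOf x = o
          · subst ho
            simp only [Instr.exec, Function.update_self] at this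
            have hr : Entry.output (L.outputOf x) ∈ s.cached := ready
            simp only [pendingStores, mem_insert]
            tauto
          · simpa [Instr.exec, pendingStores, Function.update_of_ne ho, ho] using this
      | input a =>
        obtain ⟨c, V, hs, hcost, hcov⟩ := ih C hC hI hF hO
        exact ⟨c, V, hs, hcost.trans (le_add_of_nonneg_left (hw (.input a))), hcov⟩
      | filter a =>
        obtain ⟨c, V, hs, hcost, hcov⟩ := ih C hC hI hF hO
        exact ⟨c, V, hs, hcost.trans (le_add_of_nonneg_left (hw (.filter a))), hcov⟩
    | alloc o =>
      have hcov' : ∀ (V : Finset L.Iter) (x : L.Iter),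
          x ∈ ((Instr.alloc o).exec s).main (L.outputOf x) ∨
            (x ∈ ((Instr.alloc o).exec s).fast (L.outputOf x) ∧
              .output (L.outputOf x) ∈ ((Instr.alloc o).exec s).cached ∧
              L.outputOf x ∈ pendingStores P) ∨ x ∈ V →
          x ∈ s.main (L.outputOf x) ∨ (x ∈ s.fast (L.outputOf x) ∧
            .output (L.outputOf x) ∈ s.cached ∧ L.outputOf x ∈ pendingStores P) ∨ x ∈ V := by
        intro V x
        by_cases ho : L.outputOf x = o
        · subst ho
          simp only [Instr.exec, Function.update_self, Multiset.notMem_zero]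
          tauto
        · simp [Instr.exec, ho]
      have hnot : Entry.output o ∉ C := fun h => ready (hC h)
      by_cases hp : o ∈ pendingStores P
      · have hC' : insert (.output o) C ⊆ ((Instr.alloc o).exec s).cached :=
          insert_subset_insert _ hC
        obtain ⟨c, V, hs, hcost, hcov⟩ := ih (insert (.output o) C) hC'
          (fun a ha => mem_insert.2 ((mem_insert.1 ha).imp_right (hI a)))
          (fun a ha => mem_insert.2 ((mem_insert.1 ha).imp_right (hF a)))
          (fun o' ho' ha => mem_insert.2 ((mem_insert.1 ha).imp_right (hO o' ho')))
        refine ⟨_, V, .load _ (hfit _ hC') hs, ?_, fun x hx => hcov' V x (hcov x hx)⟩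
        have h1 : insert o {o' ∈ pendingStores P | Entry.output o' ∈ C} ⊆
            {o' ∈ pendingStores P | Entry.output o' ∈ insert (.output o) C} := by
          intro o'
          simp only [mem_filter, mem_insert, Entry.output.injEq]
          rintro (rfl | h)
          · exact ⟨hp, Or.inl rfl⟩
          · exact ⟨h.1, Or.inr h.2⟩
        have h2 := hmono _ _ h1
        rw [card_insert_of_notMem (by simp [hnot])] at h2
        push_cast at h2
        simp only [Instr.cost, Entry.words, pendingStores]
        linarith
      · obtain ⟨c, V, hs, hcost, hcov⟩ := ih C (hC.trans (subset_insert _ _))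
          (fun a ha => hI a (by simpa [Instr.exec] using ha))
          (fun a ha => hF a (by simpa [Instr.exec] using ha))
          (fun o' ho' ha => hO o' ho' (by
            rcases mem_insert.1 ha with h | h
            · cases h
              exact absurd ho' hp
            · exact h))
        refine ⟨c, V, hs, ?_, fun x hx => hcov' V x (hcov x hx)⟩
        simpa [Instr.cost, pendingStores] using hcost
    | evict e =>
      have hsub : ∀ a ∈ s.cached.erase e, a ∈ C → a ∈ C.erase e :=
        fun a ha hc => mem_erase.2 ⟨ne_of_mem_erase ha, hc⟩
      have hpend : ∀ o, Entry.output o ≠ e →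
          (o ∈ pendingStores (.evict e :: P) ↔ o ∈ pendingStores P) := by
        intro o ho
        cases e with
        | output o' =>
          have : o ≠ o' := fun h => ho (h ▸ rfl)
          simp [pendingStores, this]
        | input a => rfl
        | filter a => rfl
      obtain ⟨c, V, hs, hcost, hcov⟩ := ih (C.erase e) (erase_subset_erase e hC)
        (fun a ha => hsub _ ha (hI a (mem_of_mem_erase ha)))
        (fun a ha => hsub _ ha (hF a (mem_of_mem_erase ha)))
        (fun o ho ha => hsub _ ha
          (hO o ((hpend o (ne_of_mem_erase ha)).2 ho) (mem_of_mem_erase ha)))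
      refine ⟨c, V, .drop (erase_subset e C) hs, ?_, fun x hx => ?_⟩
      · have := hmono {o ∈ pendingStores (.evict e :: P) | .output o ∈ C}
          {o ∈ pendingStores P | .output o ∈ C.erase e} (by
            intro o
            simp only [mem_filter, mem_erase]
            rintro ⟨ho, hoC⟩
            have hne : Entry.output o ≠ e := by
              rintro rfl
              simp [pendingStores] at ho
            exact ⟨(hpend o hne).1 ho, hne, hoC⟩)
        simp only [Instr.cost]
        linarith
      · rcases hcov x hx with h | ⟨h, hc, hp⟩ | h
        · exact Or.inl h
        · exact Or.inr (Or.inl ⟨h, mem_of_mem_erase hc, (hpend _ (ne_of_mem_erase hc)).2 hp⟩)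
        · exact Or.inr (Or.inr h)
    | update y =>
      obtain ⟨c, V, hs, hcost, hcov⟩ := ih C hC hI hF hO
      have hcost' : c + p.O * #{o ∈ pendingStores (.update y :: P) | .output o ∈ C} ≤
          Instr.cost p (.update y) + wordsMoved p P := by
        simpa [Instr.cost, pendingStores] using hcost
      have hcov' : ∀ x, x ∈ t.main (L.outputOf x) → x ∈ s.main (L.outputOf x) ∨
          (x ∈ s.fast (L.outputOf x) ∧ .output (L.outputOf x) ∈ s.cached ∧
            L.outputOf x ∈ pendingStores P) ∨ (x = y ∧ L.outputOf y ∈ pendingStores P) ∨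
            x ∈ V := by
        intro x hx
        have := hcov x hx
        by_cases ho : L.outputOf x = L.outputOf y
        · rw [ho] at this ⊢
          simp only [Instr.exec, Function.update_self, Multiset.mem_cons] at this
          tauto
        · simp only [Instr.exec, Function.update_of_ne ho] at this
          tauto
      by_cases hp : L.outputOf y ∈ pendingStores P
      · refine ⟨c, insert y V, .exec y ?_ hs, hcost', fun x hx => ?_⟩
        · simp only [operands, insert_subset_iff, singleton_subset_iff]
          exact ⟨hI _ ready.1, hF _ ready.2.1, hO _ hp ready.2.2⟩
        · have := hcov' x hx
          simp only [pendingStores, mem_insert]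
          tauto
      · refine ⟨c, V, hs, hcost', fun x hx => ?_⟩
        have := hcov' x hx
        simp only [pendingStores]
        tauto

/-- An execution of the convolution is simulated by a schedule that starts with an empty cache,
executes every update, and costs at most as much. -/
theorem IsComputation.exists_cacheSchedule {p : Precisions} {M : ℝ}
    (hw : ∀ e : L.Entry, 0 ≤ e.words p) (hpO : 0 ≤ p.O) {P : List L.Instr}
    (h : IsComputation p M P) :
    ∃ c ≤ wordsMoved p P, CacheSchedule operands (Entry.words p) M ∅ c
      (univ : Finset L.Iter) := by
  obtain ⟨t, hrun, ht⟩ := h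
  obtain ⟨c, V, hs, hc, hcov⟩ := hrun.exists_cacheSchedule hw hpO ∅ (empty_subset _)
    (fun a ha => ha) (fun a ha => ha) (fun o _ ho => ho)
  have hV : V = univ := by
    refine eq_univ_iff_forall.2 fun x => ?_
    have hx : x ∈ t.main (L.outputOf x) := by
      rw [ht]
      simp
    simpa [MemState.initial] using hcov x hx
  exact ⟨c, by simpa using hc, hV ▸ hs⟩

/-! ### Updates enabled by given sets of entries -/

/-- The weight of a set of entries is at least that of three parts of the three arrays. -/
theorem le_sum_words {p : Precisions} (hw : ∀ e : L.Entry, 0 ≤ e.words p) {S : Finset L.Entry}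
    {A : Finset L.InputIdx} {B : Finset L.FilterIdx} {C : Finset L.OutputIdx}
    (hA : ∀ a ∈ A, .input a ∈ S) (hB : ∀ b ∈ B, .filter b ∈ S) (hC : ∀ o ∈ C, .output o ∈ S) :
    p.I * #A + p.F * #B + p.O * #C ≤ ∑ e ∈ S, e.words p := by
  have hsum : ∑ e ∈ A.image Entry.input ∪ B.image Entry.filter ∪ C.image Entry.output,
      e.words p = p.I * #A + p.F * #B + p.O * #C := by
    rw [sum_union, sum_union, sum_image, sum_image, sum_image]
    · simp [Entry.words, mul_comm]
    · exact fun _ _ _ _ h => Entry.output.inj h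
    · exact fun _ _ _ _ h => Entry.filter.inj h
    · exact fun _ _ _ _ h => Entry.input.inj h
    · simp only [disjoint_left, mem_image]
      rintro _ ⟨a, _, rfl⟩ ⟨b, _, h⟩
      cases h
    · simp only [disjoint_left, mem_union, mem_image]
      rintro _ (⟨a, _, rfl⟩ | ⟨a, _, rfl⟩) ⟨b, _, h⟩ <;> cases h
  rw [← hsum]
  refine sum_le_sum_of_subset_of_nonneg ?_ fun e _ _ => hw e
  intro e
  simp only [mem_union, mem_image]
  rintro ((⟨a, ha, rfl⟩ | ⟨a, ha, rfl⟩) | ⟨a, ha, rfl⟩)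
  exacts [hA a ha, hB a ha, hC a ha]

/-- An Input and an Output entry determine the update: `i₆ = (sw * i₄ + i₆) - sw * i₄`. -/
theorem input_output_injective {x y : L.Iter} (h₁ : L.inputOf x = L.inputOf y)
    (h₂ : L.outputOf x = L.outputOf y) : x = y := by
  obtain ⟨x₁, x₂, x₃, x₄, x₅, x₆, x₇⟩ := x
  obtain ⟨y₁, y₂, y₃, y₄, y₅, y₆, y₇⟩ := y
  simp only [inputOf, outputOf, Prod.mk.injEq, Fin.mk.injEq] at h₁ h₂
  obtain ⟨rfl, rfl, rfl, rfl⟩ := h₂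
  simp only [Prod.mk.injEq, Fin.ext_iff]
  obtain ⟨-, h, h', h''⟩ := h₁
  subst h
  simp only [true_and]
  exact ⟨by omega, by omega⟩

/-- An Input and a Filter entry determine the update: `sw * i₄ = (sw * i₄ + i₆) - i₆`. -/
theorem input_filter_injective (hsw : 0 < L.sw) (hsh : 0 < L.sh) {x y : L.Iter}
    (h₁ : L.inputOf x = L.inputOf y) (h₂ : L.filterOf x = L.filterOf y) : x = y := by
  obtain ⟨x₁, x₂, x₃, x₄, x₅, x₆, x₇⟩ := x
  obtain ⟨y₁, y₂, y₃, y₄, y₅, y₆, y₇⟩ := y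
  simp only [inputOf, filterOf, Prod.mk.injEq, Fin.mk.injEq] at h₁ h₂
  obtain ⟨rfl, rfl, rfl, rfl⟩ := h₂
  obtain ⟨rfl, -, h', h''⟩ := h₁
  have h4 : x₄ = y₄ := Fin.ext (Nat.eq_of_mul_eq_mul_left hsw (Nat.add_right_cancel h'))
  have h5 : x₅ = y₅ := Fin.ext (Nat.eq_of_mul_eq_mul_left hsh (Nat.add_right_cancel h''))
  rw [h4, h5]

theorem filter_output_injective {x y : L.Iter} (h₁ : L.filterOf x = L.filterOf y)
    (h₂ : L.outputOf x = L.outputOf y) : x = y := by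
  obtain ⟨x₁, x₂, x₃, x₄, x₅, x₆, x₇⟩ := x
  obtain ⟨y₁, y₂, y₃, y₄, y₅, y₆, y₇⟩ := y
  simp_all [filterOf, outputOf]

theorem card_le_card_image_mul {α β γ : Type*} [DecidableEq β] [DecidableEq γ] (V : Finset α)
    (f : α → β) (g : α → γ) (h : ∀ x y, f x = f y → g x = g y → x = y) :
    #V ≤ #(V.image f) * #(V.image g) := by
  rw [← card_product]
  refine card_le_card_of_injOn (fun x => (f x, g x)) (fun x hx => ?_) fun x _ y _ hxy => ?_
  · exact mem_coe.2 (mk_mem_product (mem_image_of_mem f hx) (mem_image_of_mem g hx))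
  · exact h x y (congrArg Prod.fst hxy) (congrArg Prod.snd hxy)

/-- A discrete Loomis–Whitney inequality: a set is bounded through three maps `f`, `g`, `h` if for
two points with the same value of `f`, the values of `g` at the first point and of `h` at the
second one determine both points. -/
theorem card_sq_le_of_fibers {α β γ δ : Type*} [DecidableEq β] [DecidableEq γ] [DecidableEq δ]
    (V : Finset α) (f : α → β) (g : α → γ) (h : α → δ)
    (hinj : ∀ x x' y y', f x = f x' → f y = f y' → g x = g y → h x' = h y' → x = y ∧ x' = y') :
    #V ^ 2 ≤ #(V.image f) * (#(V.image g) * #(V.image h)) := by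
  classical
  have hcard : #V = ∑ b ∈ V.image f, #{x ∈ V | f x = b} :=
    card_eq_sum_card_fiberwise fun x hx => mem_image_of_mem f hx
  -- Cauchy–Schwarz over the fibers of `f`, then pairs in a common fiber are counted.
  calc #V ^ 2 = (∑ b ∈ V.image f, #{x ∈ V | f x = b}) ^ 2 := by rw [← hcard]
    _ ≤ #(V.image f) * ∑ b ∈ V.image f, #{x ∈ V | f x = b} ^ 2 := sq_sum_le_card_mul_sum_sq
    _ ≤ #(V.image f) * (#(V.image g) * #(V.image h)) := ?_
  refine Nat.mul_le_mul_left _ ?_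
  calc ∑ b ∈ V.image f, #{x ∈ V | f x = b} ^ 2
      = #((V.image f).sigma fun b => {x ∈ V | f x = b} ×ˢ {x ∈ V | f x = b}) := by
        simp [card_sigma, sq]
    _ ≤ #(V.image g ×ˢ V.image h) := by
        refine card_le_card_of_injOn (fun z => (g z.2.1, h z.2.2)) ?_ ?_
        · rintro ⟨b, x, x'⟩ hz
          simp only [coe_sigma, Set.mem_sigma_iff, mem_coe, mem_product, mem_filter] at hz
          exact mem_coe.2 (mk_mem_product (mem_image_of_mem g hz.2.1.1)
            (mem_image_of_mem h hz.2.2.1))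
        · rintro ⟨b, x, x'⟩ hz ⟨b', y, y'⟩ hz' heq
          simp only [coe_sigma, Set.mem_sigma_iff, mem_coe, mem_product, mem_filter] at hz hz'
          obtain ⟨-, ⟨-, rfl⟩, -, hx'⟩ := hz
          obtain ⟨-, ⟨-, rfl⟩, -, hy'⟩ := hz'
          obtain ⟨rfl, rfl⟩ := hinj x x' y y' hx'.symm hy'.symm (congrArg Prod.fst heq)
            (congrArg Prod.snd heq)
          rfl
    _ = #(V.image g) * #(V.image h) := card_product _ _

/-- A position `s * i + j` together with `j / s` determines `i` and `j`. -/
theorem eq_of_stride_eq {s i j i' j' : ℕ} (hs : 0 < s) (h : s * i + j = s * i' + j')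
    (hd : j / s = j' / s) : i = i' ∧ j = j' := by
  have h1 := congrArg (· / s) h
  simp only [Nat.mul_add_div hs] at h1
  have hi : i = i' := by omega
  subst hi
  exact ⟨rfl, by omega⟩

/-- With `i₆ = sw * q₆ + r₆` and `i₇ = sh * q₇ + r₇`, the pair `(q₆, q₇)` has
`(wF / sw) * (hF / sh)` values, and once it is fixed, the update accesses the arrays as a matrix
multiplication does, with the index groups `(i₁, i₄, i₅)`, `(i₂, r₆, r₇)` and `i₃`. -/
theorem card_sq_le (hsw : 0 < L.sw) (hsh : 0 < L.sh) (hw : L.sw ∣ L.wF) (hh : L.sh ∣ L.hF)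
    (V : Finset L.Iter) :
    #V ^ 2 ≤ (L.wF / L.sw * (L.hF / L.sh)) *
      (#(V.image L.inputOf) * #(V.image L.filterOf) * #(V.image L.outputOf)) := by
  let q : L.Iter → ℕ × ℕ := fun (_, _, _, _, _, i₆, i₇) => (i₆ / L.sw, i₇ / L.sh)
  have hsq := card_sq_le_of_fibers V (fun x => (L.inputOf x, q x)) L.filterOf L.outputOf (by
    rintro ⟨x₁, x₂, x₃, x₄, x₅, x₆, x₇⟩ ⟨x₁', x₂', x₃', x₄', x₅', x₆', x₇'⟩
      ⟨y₁, y₂, y₃, y₄, y₅, y₆, y₇⟩ ⟨y₁', y₂', y₃', y₄', y₅', y₆', y₇'⟩ hx hy hg ho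
    simp only [inputOf, filterOf, outputOf, q, Prod.mk.injEq, Fin.mk.injEq] at hx hy hg ho
    obtain ⟨⟨rfl, rfl, h4, h5⟩, h6, h7⟩ := hx
    obtain ⟨⟨rfl, rfl, k4, k5⟩, k6, k7⟩ := hy
    obtain ⟨e4, e6⟩ := eq_of_stride_eq hsw h4 h6
    obtain ⟨e5, e7⟩ := eq_of_stride_eq hsh h5 h7
    obtain ⟨d4, d6⟩ := eq_of_stride_eq hsw k4 k6
    obtain ⟨d5, d7⟩ := eq_of_stride_eq hsh k5 k7
    rw [← Fin.ext_iff] at e4 e5 e6 e7 d4 d5 d6 d7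
    subst e4 e5 e6 e7 d4 d5 d6 d7
    simp_all)
  have himage : #(V.image fun x => (L.inputOf x, q x)) ≤
      #(V.image L.inputOf) * (L.wF / L.sw * (L.hF / L.sh)) := by
    calc _ ≤ #(V.image L.inputOf ×ˢ (range (L.wF / L.sw) ×ˢ range (L.hF / L.sh))) := by
          refine card_le_card (image_subset_iff.2 fun x hx => ?_)
          refine mk_mem_product (mem_image_of_mem _ hx) (mk_mem_product ?_ ?_)
          · exact mem_range.2 (Nat.div_lt_div_of_lt_of_dvd hw x.2.2.2.2.2.1.isLt)
          · exact mem_range.2 (Nat.div_lt_div_of_lt_of_dvd hh x.2.2.2.2.2.2.isLt)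
      _ = _ := by simp [card_product]
  calc #V ^ 2 ≤ _ := hsq
    _ ≤ _ := Nat.mul_le_mul_right _ himage
    _ = _ := by ring

theorem inputOf_surjective (hwO : 0 < L.wO) (hhO : 0 < L.hO) (hcO : 0 < L.cO)
    (hsw : 0 < L.sw) (hsh : 0 < L.sh) (hswF : L.sw ≤ L.wF) (hshF : L.sh ≤ L.hF) :
    Function.Surjective L.inputOf := by
  -- Consecutive windows of length `w ≥ s` at distance `s` leave no gap.
  have key : ∀ {s n w : ℕ}, 0 < n → 0 < s → s ≤ w → ∀ k < s * (n - 1) + w,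
      ∃ i < n, ∃ j < w, s * i + j = k := by
    intro s n w hn hs hsw k hk
    by_cases h : k / s ≤ n - 1
    · exact ⟨k / s, by omega, k % s, (Nat.mod_lt k hs).trans_le hsw, Nat.div_add_mod k s⟩
    · have : s * (n - 1) ≤ k :=
        (Nat.mul_le_mul_left s (by omega)).trans (Nat.mul_div_le k s)
      exact ⟨n - 1, by omega, k - s * (n - 1), by omega, by omega⟩
  rintro ⟨a, b, k, l⟩
  obtain ⟨i, hi, j, hj, h⟩ := key hwO hsw hswF k k.isLt
  obtain ⟨i', hi', j', hj', h'⟩ := key hhO hsh hshF l l.isLt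
  exact ⟨(a, b, ⟨0, hcO⟩, ⟨i, hi⟩, ⟨i', hi'⟩, ⟨j, hj⟩, ⟨j', hj'⟩),
    by simp [inputOf, h, h']⟩

end ConvLayer

/-! ### Optimization over the shares of the three arrays -/

/-- If `x`, `y`, `z` entries of the three arrays have weight at most `S`, then the least of the
products `x * y`, `x * z`, `y * z` is at most `S ^ 2 / (4 * C)`. -/
theorem Precisions.C_mul_le {p : Precisions} (hpI : 0 < p.I) (hpF : 0 < p.F) (hpO : 0 < p.O)
    {x y z n S : ℝ} (hx : 0 ≤ x) (hy : 0 ≤ y) (hz : 0 ≤ z) (hn : 0 ≤ n) (hxy : n ≤ x * y)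
    (hxz : n ≤ x * z) (hyz : n ≤ y * z) (hS : p.I * x + p.F * y + p.O * z ≤ S) :
    4 * (p.C * n) ≤ S ^ 2 := by
  -- One dominant precision: the two terms of its array are combined by AM-GM.
  have dom : ∀ a b c x y z : ℝ, 0 < a → 0 < b → 0 < c → 0 ≤ x → 0 ≤ y → 0 ≤ z →
      n ≤ x * y → n ≤ x * z → a * x + b * y + c * z ≤ S → 4 * (a * (b + c) * n) ≤ S ^ 2 := by
    intro a b c x y z ha hb hc hx hy hz h1 h2 h
    have h3 : a * (b + c) * n ≤ (a * x) * (b * y + c * z) := by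
      have := mul_le_mul_of_nonneg_left h1 (mul_pos ha hb).le
      have := mul_le_mul_of_nonneg_left h2 (mul_pos ha hc).le
      linarith
    have h4 : (a * x + (b * y + c * z)) ^ 2 ≤ S ^ 2 := pow_le_pow_left₀ (by positivity)
      (by linarith) 2
    linarith [sq_nonneg (a * x - (b * y + c * z))]
  have amgm : ∀ u v : ℝ, 0 ≤ u → 0 ≤ v → n ≤ u * v → 2 * √n ≤ u + v := by
    intro u v hu hv h
    have h1 : √n ≤ √u * √v := by
      rw [← Real.sqrt_mul hu]
      exact Real.sqrt_le_sqrt h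
    linarith [sq_nonneg (√u - √v), Real.sq_sqrt hu, Real.sq_sqrt hv]
  unfold Precisions.C
  split_ifs with h1 h2 h3
  · exact dom _ _ _ x y z hpI hpF hpO hx hy hz hxy hxz hS
  · exact dom _ _ _ y x z hpF hpI hpO hy hx hz (by linarith) hyz (by linarith)
  · exact dom _ _ _ z x y hpO hpI hpF hz hx hy (by linarith) (by linarith) (by linarith)
  · -- Twice the weight is a combination of `x + y`, `x + z`, `y + z` with coefficients that are
    -- nonnegative by the triangle inequalities.
    have t1 := mul_le_mul_of_nonneg_left (amgm x y hx hy hxy)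
      (by linarith : 0 ≤ p.I + p.F - p.O)
    have t2 := mul_le_mul_of_nonneg_left (amgm x z hx hz hxz)
      (by linarith : 0 ≤ p.I + p.O - p.F)
    have t3 := mul_le_mul_of_nonneg_left (amgm y z hy hz hyz)
      (by linarith : 0 ≤ p.F + p.O - p.I)
    have h4 : (p.I + p.F + p.O) * √n ≤ S := by linarith
    have h5 := pow_le_pow_left₀ (by positivity) h4 2
    rw [mul_pow, Real.sq_sqrt hn] at h5
    linarith

theorem mul_mul_le_cube {a b c S : ℝ} (ha : 0 ≤ a) (hb : 0 ≤ b) (hc : 0 ≤ c)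
    (h : a + b + c ≤ 3 * S) : a * b * c ≤ S ^ 3 := by
  have h1 : ((a + b + c) / 3) ^ 3 ≤ S ^ 3 := pow_le_pow_left₀ (by positivity) (by linarith) 3
  nlinarith [mul_nonneg ha (sq_nonneg (b - c)), mul_nonneg hb (sq_nonneg (a - c)),
    mul_nonneg hc (sq_nonneg (a - b)), mul_nonneg ha (sq_nonneg (a - b)),
    mul_nonneg ha (sq_nonneg (a - c)), mul_nonneg hb (sq_nonneg (b - a)),
    mul_nonneg hb (sq_nonneg (b - c)), mul_nonneg hc (sq_nonneg (c - a)),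
    mul_nonneg hc (sq_nonneg (c - b))]

/-! ### The lower bounds -/

namespace ConvLayer

variable {L : ConvLayer}

/-- The operands of a set of updates fit into `S` words only if the three projections do. -/
theorem projections_le {p : Precisions} (hw : ∀ e : L.Entry, 0 ≤ e.words p) {V : Finset L.Iter}
    {S : Finset L.Entry} (h : ∀ x ∈ V, operands x ⊆ S) :
    p.I * #(V.image L.inputOf) + p.F * #(V.image L.filterOf) + p.O * #(V.image L.outputOf) ≤
      ∑ e ∈ S, e.words p := by
  refine le_sum_words hw ?_ ?_ ?_ <;>
  · intro a ha
    obtain ⟨x, hx, rfl⟩ := mem_image.1 ha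
    exact h x hx (by simp [operands])

theorem card_iter : #(univ : Finset L.Iter) = L.numUpdates := by
  simp [numUpdates, mul_assoc]

/-- Every entry of the three arrays is used, so every entry is loaded at least once. -/
theorem sizes_le_of_cacheSchedule {p : Precisions} {M c : ℝ}
    (hN : 0 < L.N) (hcI : 0 < L.cI) (hcO : 0 < L.cO) (hwO : 0 < L.wO) (hhO : 0 < L.hO)
    (hsw : 0 < L.sw) (hsh : 0 < L.sh) (hswF : L.sw ≤ L.wF) (hshF : L.sh ≤ L.hF)
    (hw : ∀ e : L.Entry, 0 ≤ e.words p)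
    (hs : CacheSchedule operands (Entry.words p) M ∅ c (univ : Finset L.Iter)) :
    p.I * L.sizeI + p.F * L.sizeF + p.O * L.sizeO ≤ c := by
  obtain ⟨S, hS, hV⟩ := hs.exists_loaded hw
  have h := projections_le hw fun x hx => by simpa using hV x hx
  have hI : univ.image L.inputOf = univ :=
    image_univ_of_surjective (inputOf_surjective hwO hhO hcO hsw hsh hswF hshF)
  have hF : univ.image L.filterOf = univ := image_univ_of_surjective fun (b, d, k, l) =>
    ⟨(⟨0, hN⟩, b, d, ⟨0, hwO⟩, ⟨0, hhO⟩, k, l), rfl⟩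
  have hO : univ.image L.outputOf = univ := image_univ_of_surjective fun (a, d, k, l) =>
    ⟨(a, ⟨0, hcI⟩, d, k, l, ⟨0, hsw.trans_le hswF⟩, ⟨0, hsh.trans_le hshF⟩), rfl⟩
  have cI : #(univ : Finset L.InputIdx) = L.sizeI := by simp [sizeI, mul_assoc]
  have cF : #(univ : Finset L.FilterIdx) = L.sizeF := by simp [sizeF, mul_assoc]
  have cO : #(univ : Finset L.OutputIdx) = L.sizeO := by simp [sizeO, mul_assoc]
  rw [hI, hF, hO, cI, cF, cO] at h
  exact h.trans hS

end ConvLayer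

theorem Precisions.C_pos {p : Precisions} (hpI : 0 < p.I) (hpF : 0 < p.F) (hpO : 0 < p.O) :
    0 < p.C := by
  unfold Precisions.C
  split_ifs <;> positivity

namespace ConvLayer

variable {L : ConvLayer}

/-- The bound from segments of cost `M`: the `2 * M` words available in a segment enable at most
`M ^ 2 / C` updates. -/
theorem le_of_cacheSchedule {p : Precisions} {M c : ℝ} (hsw : 0 < L.sw) (hsh : 0 < L.sh)
    (hpI : 0 < p.I) (hpF : 0 < p.F) (hpO : 0 < p.O) (hM : 0 < M)
    (hs : CacheSchedule operands (Entry.words p) M ∅ c (univ : Finset L.Iter)) :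
    p.C * L.numUpdates / M - M ≤ c := by
  have hw : ∀ e : L.Entry, 0 ≤ e.words p := fun e => (e.words_pos hpI hpF hpO).le
  have hC := Precisions.C_pos hpI hpF hpO
  have h := hs.mul_card_le hw (K := M ^ 2 / p.C) hM le_rfl (by
    intro V S hS hV
    have h1 : #V ≤ #(V.image L.inputOf) * #(V.image L.filterOf) :=
      card_le_card_image_mul V _ _ fun _ _ => input_filter_injective hsw hsh
    have h2 : #V ≤ #(V.image L.inputOf) * #(V.image L.outputOf) :=
      card_le_card_image_mul V _ _ fun _ _ => input_output_injective
    have h3 : #V ≤ #(V.image L.filterOf) * #(V.image L.outputOf) :=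
      card_le_card_image_mul V _ _ fun _ _ => filter_output_injective
    have h4 := Precisions.C_mul_le hpI hpF hpO (Nat.cast_nonneg _) (Nat.cast_nonneg _)
      (Nat.cast_nonneg _) (Nat.cast_nonneg #V) (by exact_mod_cast h1) (by exact_mod_cast h2)
      (by exact_mod_cast h3) ((projections_le hw hV).trans hS)
    rw [le_div_iff₀ hC]
    linarith)
  rw [card_iter] at h
  have h5 : p.C * (M * L.numUpdates) ≤ M ^ 2 * (c + M) := by
    calc p.C * (M * L.numUpdates) ≤ p.C * (M ^ 2 / p.C * (c + M)) := by gcongr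
      _ = M ^ 2 * (c + M) := by field_simp
  rw [sub_le_iff_le_add, div_le_iff₀ hM]
  exact le_of_mul_le_mul_left (by linarith) hM

/-- The bound from segments of cost `2 * M`: the three projections of the updates in a segment
share `3 * M` words, so `p.I * p.F * p.O` times the product of their sizes is at most `M ^ 3`. -/
theorem le_of_cacheSchedule_of_dvd {p : Precisions} {M c : ℝ} (hsw : 0 < L.sw) (hsh : 0 < L.sh)
    (hswF : L.sw ≤ L.wF) (hshF : L.sh ≤ L.hF) (hdw : L.sw ∣ L.wF) (hdh : L.sh ∣ L.hF)
    (hpI : 0 < p.I) (hpF : 0 < p.F) (hpO : 0 < p.O) (hM : 0 < M)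
    (hs : CacheSchedule operands (Entry.words p) M ∅ c (univ : Finset L.Iter)) :
    2 * √(p.I * p.F * p.O) * √(L.sw * L.sh) * L.numUpdates / √(L.wF * L.hF * M) - 2 * M ≤ c := by
  have hw : ∀ e : L.Entry, 0 ≤ e.words p := fun e => (e.words_pos hpI hpF hpO).le
  have hsw' : (0 : ℝ) < L.sw := by exact_mod_cast hsw
  have hsh' : (0 : ℝ) < L.sh := by exact_mod_cast hsh
  have hwF' : (0 : ℝ) < L.wF := by exact_mod_cast hsw.trans_le hswF
  have hhF' : (0 : ℝ) < L.hF := by exact_mod_cast hsh.trans_le hshF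
  have hp3 : 0 < p.I * p.F * p.O := by positivity
  set A := √(p.I * p.F * p.O) with hA
  set B := √((L.sw : ℝ) * L.sh) with hB
  set D := √((L.wF : ℝ) * L.hF * M) with hD
  have hA0 : 0 < A := Real.sqrt_pos.2 hp3
  have hB0 : 0 < B := Real.sqrt_pos.2 (by positivity)
  have hD0 : 0 < D := Real.sqrt_pos.2 (by positivity)
  have hA2 : A ^ 2 = p.I * p.F * p.O := Real.sq_sqrt hp3.le
  have hB2 : B ^ 2 = L.sw * L.sh := Real.sq_sqrt (by positivity)
  have hD2 : D ^ 2 = L.wF * L.hF * M := Real.sq_sqrt (by positivity)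
  have h := hs.mul_card_le hw (T := 2 * M) (K := M * D / (A * B)) hM (by linarith) (by
    intro V S hS hV
    have h1 := (projections_le hw hV).trans hS
    set x := #(V.image L.inputOf)
    set y := #(V.image L.filterOf)
    set z := #(V.image L.outputOf)
    have h2 : (p.I * x) * (p.F * y) * (p.O * z) ≤ M ^ 3 :=
      mul_mul_le_cube (by positivity) (by positivity) (by positivity) (by linarith)
    have h3 : (#V : ℝ) ^ 2 ≤ (L.wF / L.sw * (L.hF / L.sh)) * (x * y * z) := by
      have h4 : ((#V ^ 2 : ℕ) : ℝ) ≤ _ := Nat.cast_le.2 (card_sq_le hsw hsh hdw hdh V)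
      push_cast [Nat.cast_div hdw hsw'.ne', Nat.cast_div hdh hsh'.ne'] at h4
      exact h4
    refine (sq_le_sq₀ (by positivity) (by positivity)).1 ?_
    rw [div_pow, mul_pow, mul_pow, hA2, hB2, hD2, le_div_iff₀ (by positivity)]
    calc (#V : ℝ) ^ 2 * (p.I * p.F * p.O * (L.sw * L.sh))
        ≤ (L.wF / L.sw * (L.hF / L.sh)) * (x * y * z) * (p.I * p.F * p.O * (L.sw * L.sh)) := by
          gcongr
      _ = L.wF * L.hF * ((p.I * x) * (p.F * y) * (p.O * z)) := by field_simp
      _ ≤ L.wF * L.hF * M ^ 3 := by gcongr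
      _ = M ^ 2 * (L.wF * L.hF * M) := by ring)
  rw [card_iter, div_mul_eq_mul_div, le_div_iff₀ (by positivity)] at h
  rw [sub_le_iff_le_add, div_le_iff₀ hD0]
  exact le_of_mul_le_mul_left (by linarith) hM

end ConvLayer

theorem theorem1 (L : ConvLayer) (p : Precisions) (M : ℝ)
    (hN : 0 < L.N) (hcI : 0 < L.cI) (hcO : 0 < L.cO) (hwO : 0 < L.wO) (hhO : 0 < L.hO)
    (hsw : 0 < L.sw) (hsh : 0 < L.sh) (hswF : L.sw ≤ L.wF) (hshF : L.sh ≤ L.hF)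
    (hpI : 0 < p.I) (hpF : 0 < p.F) (hpO : 0 < p.O) (hM : 0 < M)
    (P : List L.Instr) (hP : ConvLayer.IsComputation p M P) :
    max (p.I * L.sizeI + p.F * L.sizeF + p.O * L.sizeO) (p.C * L.numUpdates / M - M)
        ≤ ConvLayer.wordsMoved p P ∧
      (L.sw ∣ L.wF → L.sh ∣ L.hF →
        max (max (p.I * L.sizeI + p.F * L.sizeF + p.O * L.sizeO) (p.C * L.numUpdates / M - M))
          (2 * √(p.I * p.F * p.O) * √(L.sw * L.sh) * L.numUpdates / √(L.wF * L.hF * M) - 2 * M)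
          ≤ ConvLayer.wordsMoved p P) := by
  obtain ⟨c, hc, hs⟩ := hP.exists_cacheSchedule (fun e => (e.words_pos hpI hpF hpO).le) hpO.le
  have h1 := (ConvLayer.sizes_le_of_cacheSchedule hN hcI hcO hwO hhO hsw hsh hswF hshF
    (fun e => (e.words_pos hpI hpF hpO).le) hs).trans hc
  have h2 := (ConvLayer.le_of_cacheSchedule hsw hsh hpI hpF hpO hM hs).trans hc
  refine ⟨max_le h1 h2, fun hdw hdh => max_le (max_le h1 h2) ?_⟩
  exact (ConvLayer.le_of_cacheSchedule_of_dvd hsw hsh hswF hshF hdw hdh hpI hpF hpO hM hs).trans hc
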